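/- Let $\Omega\subset\mathbb{C}\cong\mathbb{R}^2$ be open and connected, let $F=F_1+\mathrm{i}F_2:\Omega\to\mathbb{C}$ be holomorphic, $F\not\equiv 0$, and let $a\in\Omega$ be a zero of $F$ of order $m\ge 2$. Consider $\dot x=F(x)$ with real time $t$. For $x_0\in\Omega$ let $t\mapsto\Phi(t,x_0)$ be the maximal solution with $\Phi(0,x_0)=x_0$, defined on the maximal open interval $I(x_0)$, and let $\Gamma_{+}(x_0)$ and $\Gamma_-(x_0)$ be the images of $I(x_0)\cap[0,\infty)$ and $I(x_0)\cap(-\infty,0]$ under $\Phi(\cdot,x_0)$. The orbit through $x_0$ *tends to $a$ for $t\to\infty$* if $[0,\infty)\subset I(x_0)$ and $\Phi(t,x_0)\to a$ for $t\to\infty$; it does so *in the definite direction* $\theta_0$ if moreover $\Phi(t,x_0)\neq a$ for all large $t$ and $\arg(\Phi(t,x_0)-a)\to\theta_0$ modulo $2\pi$; similarly for $t\to-\infty$. Let $F_j^{[m]}(x_1,x_2)$ be the sum of all terms of degree $m$ of the real Taylor series of $F_j$ at $a$ (as a polynomial in the displacement $(x_1,x_2)$ from $a$), let $H(x_1,x_2)=x_1F_2^{[m]}(x_1,x_2)-x_2F_1^{[m]}(x_1,x_2)$,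 and put $$\mathcal{E}(F,m)=\left\{\frac{\ell\pi-\arg(F^{(m)}(a))}{m-1}\bmod 2\pi:\ell\in\mathbb{Z}\right\}\subset[0,2\pi),\qquad \lambda(\theta_0)=\cos\left(\arg(F^{(m)}(a))+(m-1)\theta_0\right).$$ For $\theta_0\in\mathbb{R}$ and $r,\delta>0$ let $A_{\theta_0}(r,\delta)=\{x\in\mathbb{C}: x\ne a,\ |x-a|<r,\ |\arg(x-a)-\theta_0|<\delta\}$, where the distance of angles is taken modulo $2\pi$. Then: (i) $\theta_0\in[0,2\pi)$ satisfies $H(\cos\theta_0,\sin\theta_0)=0$ if and only if $\theta_0\in\mathcal{E}(F,m)$, and $|\mathcal{E}(F,m)|=2m-2$. (ii) For every $x_0\in\Omega\setminus\{a\}$: if the orbit through $x_0$ tends to $a$ for $t\to\infty$ (for $t\to-\infty$), then it does so for $t\to\infty$ (for $t\to-\infty$) in a definite direction $\theta_0\in\mathcal{E}(F,m)$. For every $\theta_0\in\mathcal{E}(F,m)$ there are $r,\delta>0$ such that: (iii) $A_{\theta_0}(r,\delta)\subset\Omega$, and for every $x_0\in A_{\theta_0}(r,\delta)$ the orbit through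 $x_0$ tends to $a$ in the definite direction $\theta_0$ for $t\to\infty$ or for $t\to-\infty$. It tends to $a$ in the direction $\theta_0$ for $t\to\infty$ if and only if $\lambda(\theta_0)<0$, and for $t\to-\infty$ if and only if $\lambda(\theta_0)>0$. (iv) There are $\hat r\in(0,r)$ and $\hat\delta\in(0,\delta)$ such that for all $x_0\in A_{\theta_0}(\hat r,\hat\delta)$: if $\lambda(\theta_0)<0$, then $\Gamma_+(x_0)\subset A_{\theta_0}(r,\delta)$, and if $\lambda(\theta_0)>0$, then $\Gamma_-(x_0)\subset A_{\theta_0}(r,\delta)$. -/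

import Mathlib

open Set Filter Topology

noncomputable section

namespace HolFlow

/-- `x` solves `x' = F x`, `x 0 = x₀` inside `Ω` on the open interval `I` of real times. -/
structure IsSolution (Ω : Set ℂ) (F : ℂ → ℂ) (x₀ : ℂ) (I : Set ℝ) (x : ℝ → ℂ) : Prop where
  isOpen : IsOpen I
  ordConnected : I.OrdConnected
  zero_mem : (0 : ℝ) ∈ I
  initial : x 0 = x₀
  mapsTo : MapsTo x I Ω
  hasDerivAt : ∀ t ∈ I, HasDerivAt x (F (x t)) t

/-- The maximal interval of existence `I(x₀)`: all times reached by some solution through `x₀`. -/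
def maxInterval (Ω : Set ℂ) (F : ℂ → ℂ) (x₀ : ℂ) : Set ℝ :=
  {t | ∃ (I : Set ℝ) (x : ℝ → ℂ), IsSolution Ω F x₀ I x ∧ t ∈ I}

open Classical in
/-- The flow `Φ(t, x₀)`, for `t` in the maximal interval `I(x₀)`: the common value at time `t` of
all solutions through `x₀` (see `flow_eq`). Outside `I(x₀)` the value is irrelevant. -/
def flow (Ω : Set ℂ) (F : ℂ → ℂ) (x₀ : ℂ) (t : ℝ) : ℂ :=
  if h : t ∈ maxInterval Ω F x₀ then h.choose_spec.choose t else x₀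

theorem IsSolution.eq_of_mem {Ω : Set ℂ} {F : ℂ → ℂ} (hΩ : IsOpen Ω)
    (hF : DifferentiableOn ℂ F Ω) {x₀ : ℂ} {I J : Set ℝ} {x y : ℝ → ℂ}
    (hx : IsSolution Ω F x₀ I x) (hy : IsSolution Ω F x₀ J y) {t : ℝ} (hI : t ∈ I) (hJ : t ∈ J) :
    x t = y t := by
  have hpre : IsPreconnected (I ∩ J) :=
    (hx.ordConnected.inter hy.ordConnected).isPreconnected
  have hopen : IsOpen (I ∩ J) := hx.isOpen.inter hy.isOpen
  have key : I ∩ J ⊆ {s | x =ᶠ[𝓝 s] y} := by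
    have hloc : ∀ s ∈ I ∩ J, x s = y s → x =ᶠ[𝓝 s] y := by
      intro s hs hxy
      have hd : ContDiffAt ℝ 1 F (x s) :=
        ((hF.analyticAt (hΩ.mem_nhds (hx.mapsTo hs.1))).contDiffAt).restrict_scalars ℝ
      obtain ⟨K, U, hU, hK⟩ := hd.exists_lipschitzOnWith
      have hxU : ∀ᶠ r in 𝓝 s, x r ∈ U := (hx.hasDerivAt s hs.1).continuousAt hU
      have hyU : ∀ᶠ r in 𝓝 s, y r ∈ U :=
        (hy.hasDerivAt s hs.2).continuousAt (by rw [← hxy]; exact hU)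
      refine ODE_solution_unique_of_eventually (v := fun _ => F) (s := fun _ => U) (K := K)
        (Eventually.of_forall fun _ => hK) ?_ ?_ hxy
      · filter_upwards [hxU, hx.isOpen.mem_nhds hs.1] with r hr hrI
        exact ⟨hx.hasDerivAt r hrI, hr⟩
      · filter_upwards [hyU, hy.isOpen.mem_nhds hs.2] with r hr hrJ
        exact ⟨hy.hasDerivAt r hrJ, hr⟩
    refine hpre.subset_of_closure_inter_subset ?_
      ⟨0, ⟨hx.zero_mem, hy.zero_mem⟩, hloc 0 ⟨hx.zero_mem, hy.zero_mem⟩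
        (hx.initial.trans hy.initial.symm)⟩ ?_
    · exact isOpen_iff_mem_nhds.2 fun s hs => eventually_eventually_nhds.2 hs
    · rintro s ⟨hs, hsIJ⟩
      refine hloc s hsIJ ?_
      by_contra hne
      have h1 : ∀ᶠ r in 𝓝 s, x r ≠ y r :=
        ((hx.hasDerivAt s hsIJ.1).continuousAt.prodMk
          (hy.hasDerivAt s hsIJ.2).continuousAt).eventually
          (isClosed_diagonal.isOpen_compl.mem_nhds hne)
      obtain ⟨r, hr, hr'⟩ := mem_closure_iff_nhds.1 hs _ h1
      exact hr hr'.self_of_nhds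
  exact (key ⟨hI, hJ⟩ : x =ᶠ[𝓝 t] y).self_of_nhds

/-- The flow agrees with every solution through `x₀`. -/
theorem flow_eq {Ω : Set ℂ} {F : ℂ → ℂ} (hΩ : IsOpen Ω) (hF : DifferentiableOn ℂ F Ω)
    {x₀ : ℂ} {I : Set ℝ} {x : ℝ → ℂ} (hx : IsSolution Ω F x₀ I x) {t : ℝ} (ht : t ∈ I) :
    flow Ω F x₀ t = x t := by
  have h : t ∈ maxInterval Ω F x₀ := ⟨I, x, hx, ht⟩
  rw [flow, dif_pos h]
  exact h.choose_spec.choose_spec.1.eq_of_mem hΩ hF hx h.choose_spec.choose_spec.2 ht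

/-- The forward half-orbit `Γ₊(x₀)`. -/
def forwardOrbit (Ω : Set ℂ) (F : ℂ → ℂ) (x₀ : ℂ) : Set ℂ :=
  flow Ω F x₀ '' (maxInterval Ω F x₀ ∩ Ici 0)

/-- The backward half-orbit `Γ₋(x₀)`. -/
def backwardOrbit (Ω : Set ℂ) (F : ℂ → ℂ) (x₀ : ℂ) : Set ℂ :=
  flow Ω F x₀ '' (maxInterval Ω F x₀ ∩ Iic 0)

/-- The orbit through `x₀` exists for all positive times and tends to `a` for `t → ∞`. -/
def TendsForward (Ω : Set ℂ) (F : ℂ → ℂ) (a x₀ : ℂ) : Prop :=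
  Ici 0 ⊆ maxInterval Ω F x₀ ∧ Tendsto (flow Ω F x₀) atTop (𝓝 a)

/-- The orbit through `x₀` exists for all negative times and tends to `a` for `t → -∞`. -/
def TendsBackward (Ω : Set ℂ) (F : ℂ → ℂ) (a x₀ : ℂ) : Prop :=
  Iic 0 ⊆ maxInterval Ω F x₀ ∧ Tendsto (flow Ω F x₀) atBot (𝓝 a)

/-- The orbit through `x₀` tends to `a` in the definite direction `θ₀` for `t → ∞`:
`arg (Φ(t, x₀) - a) → θ₀`, where angles are taken modulo `2π`. -/
def TendsForwardInDirection (Ω : Set ℂ) (F : ℂ → ℂ) (a x₀ : ℂ) (θ₀ : ℝ) : Prop :=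
  TendsForward Ω F a x₀ ∧ (∀ᶠ t in atTop, flow Ω F x₀ t ≠ a) ∧
    Tendsto (fun t => ((flow Ω F x₀ t - a).arg : Real.Angle)) atTop (𝓝 (θ₀ : Real.Angle))

/-- The orbit through `x₀` tends to `a` in the definite direction `θ₀` for `t → -∞`. -/
def TendsBackwardInDirection (Ω : Set ℂ) (F : ℂ → ℂ) (a x₀ : ℂ) (θ₀ : ℝ) : Prop :=
  TendsBackward Ω F a x₀ ∧ (∀ᶠ t in atBot, flow Ω F x₀ t ≠ a) ∧
    Tendsto (fun t => ((flow Ω F x₀ t - a).arg : Real.Angle)) atBot (𝓝 (θ₀ : Real.Angle))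

/-- The sector `A(r, δ)` with vertex `a` around the direction `θ₀`. The vertex, where the argument
is undefined, is excluded; the distance of angles is taken modulo `2π`. -/
def sector (a : ℂ) (θ₀ r δ : ℝ) : Set ℂ :=
  {x | x ≠ a ∧ ‖x - a‖ < r ∧ |(((x - a).arg : Real.Angle) - (θ₀ : Real.Angle)).toReal| < δ}

/-- The sum `f^[k]` of all terms of degree `k` of the real Taylor series of `f` at `a`, as a
homogeneous polynomial in the displacement `(x₁, x₂)` from `a`, that is
`(1 / k!) D^k f(a) (v, …, v)` with `v = (x₁, x₂)`. -/
def taylorPart (f : ℂ → ℝ) (a : ℂ) (k : ℕ) (x₁ x₂ : ℝ) : ℝ :=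
  (k.factorial : ℝ)⁻¹ * iteratedFDeriv ℝ k f a (fun _ => (⟨x₁, x₂⟩ : ℂ))

/-- `H(x₁, x₂) = x₁ F₂^[m](x₁, x₂) - x₂ F₁^[m](x₁, x₂)` where `F = F₁ + i F₂`. -/
def H (F : ℂ → ℂ) (a : ℂ) (m : ℕ) (x₁ x₂ : ℝ) : ℝ :=
  x₁ * taylorPart (fun z => (F z).im) a m x₁ x₂ - x₂ * taylorPart (fun z => (F z).re) a m x₁ x₂

/-- The set of angles `(ℓ π - arg F^(m)(a)) / (m - 1)` modulo `2π`, in `[0, 2π)`. -/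
def directions (F : ℂ → ℂ) (a : ℂ) (m : ℕ) : Set ℝ :=
  range fun ℓ : ℤ =>
    toIcoMod Real.two_pi_pos 0 ((ℓ * Real.pi - (iteratedDeriv m F a).arg) / ((m : ℝ) - 1))

/-- `λ(θ₀) = cos (arg F^(m)(a) + θ₀ (m - 1))`. -/
def lam (F : ℂ → ℂ) (a : ℂ) (m : ℕ) (θ₀ : ℝ) : ℝ :=
  Real.cos ((iteratedDeriv m F a).arg + θ₀ * ((m : ℝ) - 1))

end HolFlow

end

/-!
Write `m = n + 1` and let `c = F^(m)(a) / m!`, so that `F z / (z - a) ^ m → c` as `z → a`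
(`tendsto_div_pow`). The coordinate `w = -1 / (n c (z - a)ⁿ)` (`fatou`) turns `z' = F z` into an
equation whose right-hand side tends to `1` as `z → a`, that is as `w → ∞`: near `a` the orbits are
almost horizontal curves in the `w`-plane, traversed from left to right. Since
`arg w = π - arg c - n arg (z - a)`, the rays `arg (z - a) = θ₀` on which `w` is positive are those
with `c e^(i n θ₀) < 0`, which are the directions with `λ(θ₀) < 0`.

* If an orbit tends to `a` for `t → ∞`, then `w / t → 1`, hence `arg w → 0`. From then on
  `arg (z - a) + arg w / n` is constant modulo `2π`, because it is the argument of an `n`-th root of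
  a constant (`arg_add_arg_fatou_const`). So `arg (z - a)` converges
  (`TendsForward.exists_tendsto_arg`).
* The sector of half-width `π / (4 n)` around a direction on which `w` is positive is, in the
  coordinate `w`, one sheet of `|im w| < re w` (`mem_sector_iff`). If `|w' - 1| ≤ 1 / 4` for
  `|z - a| < r`, then this cone is invariant and `|w|` does not fall below its initial value, so that
  the orbit stays in a compact ball around `a`, exists for all positive times, and `|w| → ∞` at a
  linear rate, that is `z → a` (`forward_of_mem_sector`).

The assertions for `t → -∞` follow by replacing `F` with `-F`. The description of the directions
comes from `H (cos θ, sin θ) = im (c e^(i n θ))` (`H_cos_sin`).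
-/

namespace HolFlow

variable {Ω : Set ℂ} {F : ℂ → ℂ} {x₀ a c : ℂ} {I J : Set ℝ} {x y : ℝ → ℂ} {n m : ℕ} {r θ₀ : ℝ}

/-! ### Solutions and the flow -/

/-- Local solutions exist on a time interval which is uniform for initial values near `y`, and they
stay in `Ω`. The latter needs the continuity of the local flow, since `F` is arbitrary outside
`Ω`. -/
theorem exists_isSolution_of_mem_ball (hΩ : IsOpen Ω) (hF : DifferentiableOn ℂ F Ω) {y : ℂ}
    (hy : y ∈ Ω) : ∃ r > 0, ∃ ε > 0, ∀ x₀ ∈ Metric.ball y r,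
      ∃ x, IsSolution Ω F x₀ (Ioo (-ε) ε) x := by
  have hd : ContDiffAt ℝ 1 F y :=
    ((hF.analyticAt (hΩ.mem_nhds hy)).contDiffAt).restrict_scalars ℝ
  obtain ⟨ε, hε, _, r, _, _, hr, hpl⟩ := IsPicardLindelof.of_contDiffAt_one hd
  obtain ⟨α, hα, hαc⟩ :=
    (hpl 0).exists_forall_mem_closedBall_eq_hasDerivWithinAt_continuousOn
  have hr' : (0 : ℝ) < r := hr
  have hmem : α ⁻¹' Ω ∈ 𝓝 (y, (0 : ℝ)) := by
    have hc : ContinuousAt α (y, 0) := hαc.continuousAt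
      (prod_mem_nhds (Metric.closedBall_mem_nhds y hr') (Icc_mem_nhds (by simpa) (by simpa)))
    apply hc
    rw [(hα y (Metric.mem_closedBall_self hr'.le)).1]
    exact hΩ.mem_nhds hy
  obtain ⟨U, hU, V, hV, hUV⟩ := mem_nhds_prod_iff.1 hmem
  obtain ⟨r₁, hr₁, hr₁U⟩ := Metric.mem_nhds_iff.1 hU
  obtain ⟨ε₁, hε₁, hε₁V⟩ := Metric.mem_nhds_iff.1 hV
  refine ⟨min r r₁, lt_min hr' hr₁, min ε ε₁, lt_min hε hε₁, fun x₀ hx₀ => ⟨fun t => α (x₀, t), ?_⟩⟩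
  rw [Metric.mem_ball, lt_min_iff] at hx₀
  have h := hα x₀ (Metric.mem_closedBall.2 hx₀.1.le)
  have hlt : ∀ t ∈ Ioo (-min ε ε₁) (min ε ε₁), |t| < ε ∧ |t| < ε₁ := fun t ht =>
    lt_min_iff.1 (abs_lt.2 ht)
  refine ⟨isOpen_Ioo, ordConnected_Ioo, by simp [hε, hε₁], h.1, fun t ht => ?_, fun t ht => ?_⟩
  · exact hUV ⟨hr₁U hx₀.2, hε₁V (by simpa using (hlt t ht).2)⟩
  · obtain ⟨h1, h2⟩ := abs_lt.1 (hlt t ht).1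
    exact (h.2 t ⟨by linarith, by linarith⟩).hasDerivAt (Icc_mem_nhds (by linarith) (by linarith))

theorem zero_mem_maxInterval (hΩ : IsOpen Ω) (hF : DifferentiableOn ℂ F Ω) (hx₀ : x₀ ∈ Ω) :
    (0 : ℝ) ∈ maxInterval Ω F x₀ := by
  obtain ⟨r, hr, ε, hε, h⟩ := exists_isSolution_of_mem_ball hΩ hF hx₀
  obtain ⟨x, hx⟩ := h x₀ (Metric.mem_ball_self hr)
  exact ⟨_, x, hx, hx.zero_mem⟩

theorem isSolution_flow (hΩ : IsOpen Ω) (hF : DifferentiableOn ℂ F Ω) (hx₀ : x₀ ∈ Ω) :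
    IsSolution Ω F x₀ (maxInterval Ω F x₀) (flow Ω F x₀) := by
  refine ⟨isOpen_iff_mem_nhds.2 ?_, ⟨?_⟩, zero_mem_maxInterval hΩ hF hx₀, ?_, ?_, ?_⟩
  · rintro t ⟨I, x, hx, ht⟩
    exact mem_of_superset (hx.isOpen.mem_nhds ht) fun s hs => ⟨I, x, hx, hs⟩
  · rintro s ⟨I, x, hx, hs⟩ t ⟨J, y, hy, ht⟩ u hu
    rcases le_total 0 u with h | h
    · exact ⟨J, y, hy, hy.ordConnected.out hy.zero_mem ht ⟨h, hu.2⟩⟩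
    · exact ⟨I, x, hx, hx.ordConnected.out hs hx.zero_mem ⟨hu.1, h⟩⟩
  · obtain ⟨I, x, hx, h⟩ := zero_mem_maxInterval hΩ hF hx₀
    rw [flow_eq hΩ hF hx h, hx.initial]
  · rintro t ⟨I, x, hx, ht⟩
    rw [flow_eq hΩ hF hx ht]
    exact hx.mapsTo ht
  · rintro t ⟨I, x, hx, ht⟩
    rw [flow_eq hΩ hF hx ht]
    refine (hx.hasDerivAt t ht).congr_of_eventuallyEq ?_
    filter_upwards [hx.isOpen.mem_nhds ht] with s hs using flow_eq hΩ hF hx hs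

theorem IsSolution.shift (hx : IsSolution Ω F x₀ I x) {s : ℝ} (hs : s ∈ I) :
    IsSolution Ω F (x s) ((· + s) ⁻¹' I) (fun t => x (t + s)) where
  isOpen := hx.isOpen.preimage (by fun_prop)
  ordConnected := hx.ordConnected.preimage_mono fun _ _ h => by simpa using h
  zero_mem := by simpa using hs
  initial := by simp
  mapsTo := fun _ ht => hx.mapsTo ht
  hasDerivAt := fun t ht => (hx.hasDerivAt _ ht).comp_add_const t s

/-- A non-constant solution never reaches an equilibrium. -/
theorem IsSolution.ne_of_ne (hΩ : IsOpen Ω) (hF : DifferentiableOn ℂ F Ω) (ha : a ∈ Ω)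
    (hFa : F a = 0) (hx : IsSolution Ω F x₀ I x) (hne : x₀ ≠ a) {t : ℝ} (ht : t ∈ I) :
    x t ≠ a := by
  intro h
  have hconst : IsSolution Ω F (x t) univ (fun _ => a) :=
    ⟨isOpen_univ, ordConnected_univ, mem_univ _, h.symm, fun _ _ => ha,
      fun s _ => by simpa [hFa] using hasDerivAt_const s a⟩
  have := (hx.shift ht).eq_of_mem hΩ hF hconst (t := -t) (by simpa using hx.zero_mem) (mem_univ _)
  exact hne (by simpa [hx.initial] using this)

/-- A solution can be continued by a solution through one of its values. -/
theorem IsSolution.add_mem_maxInterval (hΩ : IsOpen Ω) (hF : DifferentiableOn ℂ F Ω)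
    (hx : IsSolution Ω F x₀ I x) {s : ℝ} (hs : s ∈ I) (hy : IsSolution Ω F (x s) J y) {t : ℝ}
    (ht : t ∈ J) : t + s ∈ maxInterval Ω F x₀ := by
  classical
  have hopen : IsOpen ((· - s) ⁻¹' J) := hy.isOpen.preimage (by fun_prop)
  have hJ : ((· - s) ⁻¹' J).OrdConnected :=
    hy.ordConnected.preimage_mono fun _ _ h => by simpa using h
  have hsJ : s ∈ (· - s) ⁻¹' J := by simpa using hy.zero_mem
  set z : ℝ → ℂ := fun u => if u ∈ I then x u else y (u - s) with hz
  have hzI : ∀ u ∈ I, z u = x u := fun u hu => if_pos hu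
  have hzJ : ∀ u ∈ (· - s) ⁻¹' J, z u = y (u - s) := by
    intro u hu
    by_cases huI : u ∈ I
    · have := (hx.shift hs).eq_of_mem hΩ hF hy (t := u - s) (by simpa using huI) hu
      rw [hzI u huI, ← this]
      simp
    · exact if_neg huI
  refine ⟨I ∪ (· - s) ⁻¹' J, z, ⟨hx.isOpen.union hopen, ?_, Or.inl hx.zero_mem,
    (hzI 0 hx.zero_mem).trans hx.initial, ?_, ?_⟩, Or.inr (by simpa using ht)⟩
  · exact isPreconnected_iff_ordConnected.1
      (hx.ordConnected.isPreconnected.union s hs hsJ hJ.isPreconnected)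
  · rintro u (hu | hu)
    · rw [hzI u hu]; exact hx.mapsTo hu
    · rw [hzJ u hu]; exact hy.mapsTo hu
  · rintro u (hu | hu)
    · rw [hzI u hu]
      refine (hx.hasDerivAt u hu).congr_of_eventuallyEq ?_
      filter_upwards [hx.isOpen.mem_nhds hu] with v hv using hzI v hv
    · rw [hzJ u hu]
      refine ((hy.hasDerivAt _ hu).comp_sub_const u s).congr_of_eventuallyEq ?_
      filter_upwards [hopen.mem_nhds hu] with v hv using hzJ v hv

/-- A forward half-orbit contained in a compact subset of `Ω` exists for all positive times. -/
theorem Ici_subset_maxInterval_of_isCompact (hΩ : IsOpen Ω) (hF : DifferentiableOn ℂ F Ω)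
    (hx₀ : x₀ ∈ Ω) {K : Set ℂ} (hK : IsCompact K) (hKΩ : K ⊆ Ω)
    (hmem : ∀ t ∈ maxInterval Ω F x₀, 0 ≤ t → flow Ω F x₀ t ∈ K) :
    Ici 0 ⊆ maxInterval Ω F x₀ := by
  have hx := isSolution_flow hΩ hF hx₀
  intro t₀ ht₀
  by_contra hnot
  set S := maxInterval Ω F x₀ ∩ Ici 0 with hS
  have hbdd : BddAbove S := ⟨t₀, fun t ht => le_of_not_gt fun hlt =>
    hnot (hx.ordConnected.out hx.zero_mem ht.1 ⟨ht₀, hlt.le⟩)⟩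
  obtain ⟨u, -, hu, huS⟩ := exists_seq_tendsto_sSup (S := S) ⟨0, hx.zero_mem, self_mem_Ici⟩ hbdd
  obtain ⟨y, hyK, φ, hφ, hlim⟩ := hK.tendsto_subseq fun n => hmem (u n) (huS n).1 (huS n).2
  obtain ⟨r, hr, ε, hε, hloc⟩ := exists_isSolution_of_mem_ball hΩ hF (hKΩ hyK)
  have h1 : ∀ᶠ n in atTop, flow Ω F x₀ (u (φ n)) ∈ Metric.ball y r :=
    hlim (Metric.ball_mem_nhds y hr)
  have h2 : ∀ᶠ n in atTop, sSup S - ε / 2 < u (φ n) :=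
    (hu.comp hφ.tendsto_atTop).eventually (lt_mem_nhds (by linarith))
  obtain ⟨n, hn1, hn2⟩ := (h1.and h2).exists
  obtain ⟨z, hz⟩ := hloc _ hn1
  -- Close to the end of the interval the orbit is near `y`, from where it can be continued for the
  -- time `ε / 2`, beyond the supremum.
  have h3 : ε / 2 + u (φ n) ∈ S := ⟨hx.add_mem_maxInterval hΩ hF (huS _).1 hz
    ⟨by linarith, by linarith⟩, mem_Ici.2 (by linarith [mem_Ici.1 (huS (φ n)).2])⟩
  linarith [le_csSup hbdd h3]

/-! ### Time reversal -/

/-- Reversing time turns solutions for `F` into solutions for `-F`. -/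
theorem IsSolution.neg (hx : IsSolution Ω F x₀ I x) :
    IsSolution Ω (-F) x₀ (Neg.neg ⁻¹' I) (fun t => x (-t)) where
  isOpen := hx.isOpen.preimage continuous_neg
  ordConnected := hx.ordConnected.preimage_anti fun _ _ h => neg_le_neg h
  zero_mem := by simpa using hx.zero_mem
  initial := by simpa using hx.initial
  mapsTo := fun _ ht => hx.mapsTo ht
  hasDerivAt := fun t ht => by
    simpa using! (hx.hasDerivAt (-t) ht).scomp t (hasDerivAt_neg t)

theorem mem_maxInterval_neg {t : ℝ} :
    t ∈ maxInterval Ω (-F) x₀ ↔ -t ∈ maxInterval Ω F x₀ := by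
  constructor
  · rintro ⟨I, x, hx, ht⟩
    exact ⟨_, _, by simpa using hx.neg, by simpa using ht⟩
  · rintro ⟨I, x, hx, ht⟩
    exact ⟨_, _, hx.neg, by simpa using ht⟩

theorem flow_neg (hΩ : IsOpen Ω) (hF : DifferentiableOn ℂ F Ω) (t : ℝ) :
    flow Ω (-F) x₀ t = flow Ω F x₀ (-t) := by
  by_cases h : -t ∈ maxInterval Ω F x₀
  · obtain ⟨I, x, hx, ht⟩ := h
    rw [flow_eq hΩ hF hx ht, flow_eq hΩ hF.neg hx.neg (by simpa using ht)]
  · rw [flow, flow, dif_neg h, dif_neg (mt mem_maxInterval_neg.1 h)]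

theorem tendsForward_neg (hΩ : IsOpen Ω) (hF : DifferentiableOn ℂ F Ω) :
    TendsForward Ω (-F) a x₀ ↔ TendsBackward Ω F a x₀ := by
  refine and_congr ⟨fun h t ht => ?_, fun h t ht => ?_⟩ ?_
  · simpa using mem_maxInterval_neg.1 (h (show -t ∈ Ici 0 by simpa using ht))
  · exact mem_maxInterval_neg.2 (h (by simpa using ht))
  · rw [funext (flow_neg hΩ hF), ← map_neg_atTop, tendsto_map'_iff]
    rfl

theorem tendsForwardInDirection_neg (hΩ : IsOpen Ω) (hF : DifferentiableOn ℂ F Ω) {θ₀ : ℝ} :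
    TendsForwardInDirection Ω (-F) a x₀ θ₀ ↔ TendsBackwardInDirection Ω F a x₀ θ₀ := by
  refine and_congr (tendsForward_neg hΩ hF) (and_congr ?_ ?_)
  · rw [← map_neg_atTop, eventually_map]
    simp only [flow_neg hΩ hF]
  · rw [← map_neg_atTop, tendsto_map'_iff]
    simp only [flow_neg hΩ hF]
    rfl

theorem forwardOrbit_neg (hΩ : IsOpen Ω) (hF : DifferentiableOn ℂ F Ω) :
    forwardOrbit Ω (-F) x₀ = backwardOrbit Ω F x₀ := by
  ext z
  constructor
  · rintro ⟨t, ⟨ht, ht0⟩, rfl⟩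
    exact ⟨-t, ⟨mem_maxInterval_neg.1 ht, by simpa using ht0⟩, (flow_neg hΩ hF t).symm⟩
  · rintro ⟨t, ⟨ht, ht0⟩, rfl⟩
    exact ⟨-t, ⟨mem_maxInterval_neg.2 (by simpa using ht), by simpa using ht0⟩, by
      simp [flow_neg hΩ hF]⟩

/-! ### The rectifying coordinate -/

/-- The coordinate `-1 / (n c (z - a)ⁿ)`, which rectifies `z' = c (z - a)ⁿ⁺¹` to `w' = 1` and sends
the equilibrium `a` to `∞` (as a function into `ℂ` it takes the irrelevant value `0` at `a`).
For `n ≠ 0` and `c ≠ 0` it is an `n`-fold covering of `ℂ \ {0}` by `ℂ \ {a}`, so that no branch of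
a root enters its definition. -/
noncomputable def fatou (a c : ℂ) (n : ℕ) (z : ℂ) : ℂ := -(n * c * (z - a) ^ n)⁻¹

theorem fatou_ne_zero (hn : n ≠ 0) (hc : c ≠ 0) {z : ℂ} (hz : z ≠ a) : fatou a c n z ≠ 0 := by
  have := sub_ne_zero.2 hz
  simp [fatou, hn, hc, this]

theorem norm_fatou (z : ℂ) : ‖fatou a c n z‖ = (n * ‖c‖ * ‖z - a‖ ^ n)⁻¹ := by
  simp [fatou]

theorem norm_sub_le_of_norm_fatou_le (hn : n ≠ 0) (hc : c ≠ 0) {z w : ℂ} (hz : z ≠ a) (hw : w ≠ a)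
    (h : ‖fatou a c n w‖ ≤ ‖fatou a c n z‖) : ‖z - a‖ ≤ ‖w - a‖ := by
  have hz' := norm_pos_iff.2 (sub_ne_zero.2 hz)
  have hw' := norm_pos_iff.2 (sub_ne_zero.2 hw)
  have hc' := norm_pos_iff.2 hc
  have hn' : (0 : ℝ) < n := by positivity
  rw [norm_fatou, norm_fatou, inv_le_inv₀ (by positivity) (by positivity)] at h
  exact (pow_le_pow_iff_left₀ (norm_nonneg _) (norm_nonneg _) hn).1
    (le_of_mul_le_mul_left h (by positivity))

theorem hasDerivAt_fatou_comp (hn : n ≠ 0) (hc : c ≠ 0) {z : ℝ → ℂ} {z' : ℂ} {t : ℝ}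
    (hz : HasDerivAt z z' t) (hne : z t ≠ a) :
    HasDerivAt (fun s => fatou a c n (z s)) (z' / (c * (z t - a) ^ (n + 1))) t := by
  have h0 : z t - a ≠ 0 := sub_ne_zero.2 hne
  have hn' : (n : ℂ) ≠ 0 := by exact_mod_cast hn
  have h := ((((hz.sub_const a).pow n).const_mul ((n : ℂ) * c)).inv
    (mul_ne_zero (mul_ne_zero hn' hc) (pow_ne_zero n h0))).neg
  refine h.congr_deriv ?_
  obtain ⟨k, rfl⟩ := Nat.exists_eq_succ_of_ne_zero hn
  simp only [Pi.pow_apply, Nat.succ_eq_add_one, Nat.add_sub_cancel] at hn' ⊢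
  field_simp
  ring

theorem coe_arg_fatou (hn : n ≠ 0) (hc : c ≠ 0) {z : ℂ} (hz : z ≠ a) :
    ((fatou a c n z).arg : Real.Angle) = Real.pi - c.arg - n • ((z - a).arg : Real.Angle) := by
  have h0 : z - a ≠ 0 := sub_ne_zero.2 hz
  have hp : c * (z - a) ^ n ≠ 0 := mul_ne_zero hc (pow_ne_zero n h0)
  have hn' : (0 : ℝ) < n := by positivity
  have h1 : (n : ℂ) * c * (z - a) ^ n = ((n : ℝ) : ℂ) * (c * (z - a) ^ n) := by
    push_cast; ring
  rw [fatou, h1, Complex.arg_neg_coe_angle (inv_ne_zero (mul_ne_zero (by exact_mod_cast hn) hp)),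
    Complex.arg_inv_coe_angle, Complex.arg_real_mul _ hn',
    Complex.arg_mul_coe_angle hc (pow_ne_zero n h0), Complex.arg_pow_coe_angle]
  abel

/-- Along a connected piece of a curve on which `fatou` avoids the negative axis,
`arg (z - a) + arg (fatou z) / n` is constant: it is the argument of
`(z - a) * (fatou z) ^ (1 / n)`, an `n`-th root of `-1 / (n c)`. -/
theorem arg_add_arg_fatou_const (hn : n ≠ 0) {S : Set ℝ} (hS : IsPreconnected S) {z : ℝ → ℂ}
    (hz : ContinuousOn z S) (hne : ∀ t ∈ S, z t ≠ a)
    (hw : ∀ t ∈ S, fatou a c n (z t) ∈ Complex.slitPlane) {s t : ℝ} (hs : s ∈ S) (ht : t ∈ S) :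
    ((z s - a).arg + ((fatou a c n (z s)).arg / n : ℝ) : Real.Angle) =
      (z t - a).arg + ((fatou a c n (z t)).arg / n : ℝ) := by
  have hn' : (n : ℂ) ≠ 0 := by exact_mod_cast hn
  set q : ℝ → ℂ := fun t => (z t - a) * Complex.exp (Complex.log (fatou a c n (z t)) / n) with hq
  have hqc : ContinuousOn q S := by
    have hf : ContinuousOn (fun t => fatou a c n (z t)) S := by
      refine ContinuousOn.neg (ContinuousOn.inv₀ (by fun_prop) fun t ht h => ?_)
      have := Complex.slitPlane_ne_zero (hw t ht)
      simp [fatou, h] at this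
    exact (hz.sub continuousOn_const).mul ((hf.clog hw).div_const _).cexp
  have hmaps : MapsTo q S (Polynomial.nthRoots n (-(n * c)⁻¹)).toFinset := by
    intro t ht
    have h0 : z t - a ≠ 0 := sub_ne_zero.2 (hne t ht)
    have hw0 := Complex.slitPlane_ne_zero (hw t ht)
    simp only [Finset.mem_coe, Multiset.mem_toFinset,
      Polynomial.mem_nthRoots (Nat.pos_of_ne_zero hn), hq]
    rw [mul_pow, ← Complex.exp_nat_mul, mul_div_cancel₀ _ hn', Complex.exp_log hw0, fatou,
      mul_inv]
    field_simp
  have harg : ∀ t ∈ S, ((q t).arg : Real.Angle) =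
      (z t - a).arg + ((fatou a c n (z t)).arg / n : ℝ) := by
    intro t ht
    rw [hq, Complex.arg_mul_coe_angle (sub_ne_zero.2 (hne t ht)) (Complex.exp_ne_zero _),
      Complex.arg_exp, Real.Angle.coe_toIocMod, Complex.div_natCast_im, Complex.log_im]
  rw [← harg s hs, ← harg t ht,
    hS.constant_of_mapsTo (Finset.finite_toSet _).isDiscrete hqc hmaps hs ht]

/-- A curve whose velocity tends to `1` is asymptotic to `t`. -/
theorem tendsto_div_atTop_of_deriv {w w' : ℝ → ℂ} (hw : ∀ᶠ t in atTop, HasDerivAt w (w' t) t)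
    (hw' : Tendsto w' atTop (𝓝 1)) : Tendsto (fun t : ℝ => w t / t) atTop (𝓝 1) := by
  rw [Metric.tendsto_atTop] at hw' ⊢
  intro ε hε
  obtain ⟨T₁, hT₁⟩ := hw' (ε / 2) (by positivity)
  obtain ⟨T₂, hT₂⟩ := eventually_atTop.1 hw
  set T := max T₁ T₂
  have hbound : ∀ t ≥ T, ‖(w t - t) - (w T - T)‖ ≤ ε / 2 * (t - T) := by
    intro t ht
    refine norm_image_sub_le_of_norm_deriv_le_segment' (f := fun t : ℝ => w t - t)
      (f' := fun t => w' t - 1) (fun s hs => ?_) (fun s hs => ?_) t ⟨ht, le_rfl⟩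
    · exact ((hT₂ s ((le_max_right _ _).trans hs.1)).sub
        (HasDerivAt.ofReal_comp (hasDerivAt_id s))).hasDerivWithinAt
    · exact (dist_eq_norm (w' s) 1 ▸ hT₁ s ((le_max_left _ _).trans hs.1)).le
  refine ⟨max (max T 1) (2 * (‖w T - T‖ + ε / 2 * |T|) / ε + 1), fun t ht => ?_⟩
  have htT : T ≤ t := (le_max_left _ _).trans ((le_max_left _ _).trans ht)
  have ht0 : 0 < t := one_pos.trans_le ((le_max_right _ _).trans ((le_max_left _ _).trans ht))
  have ht2 : 2 * (‖w T - T‖ + ε / 2 * |T|) / ε < t := by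
    linarith [(le_max_right _ _).trans ht]
  rw [div_lt_iff₀ hε] at ht2
  have htC : (t : ℂ) ≠ 0 := by exact_mod_cast ht0.ne'
  have h1 : ‖w t - t‖ < ε * t := by
    have h2 : ‖w t - t‖ ≤ ‖(w t - t) - (w T - T)‖ + ‖w T - T‖ := by
      simpa using norm_add_le ((w t - t) - (w T - T)) (w T - T)
    nlinarith [hbound t htT, neg_abs_le T]
  rw [dist_eq_norm, show w t / t - 1 = (w t - t) / t by field_simp, norm_div, Complex.norm_real,
    Real.norm_of_nonneg ht0.le, div_lt_iff₀ ht0]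
  exact h1

/-- Along a solution tending to `a`, the velocity in the coordinate `fatou` tends to `1`. Hence
`fatou` is asymptotic to `t`, and its argument tends to `0`. -/
theorem tendsto_arg_fatou_flow (hn : n ≠ 0) (hc : c ≠ 0)
    (hlim : Tendsto (fun z => F z / (z - a) ^ (n + 1)) (𝓝[≠] a) (𝓝 c))
    {z : ℝ → ℂ} (hz : ∀ᶠ t in atTop, HasDerivAt z (F (z t)) t) (hne : ∀ᶠ t in atTop, z t ≠ a)
    (hza : Tendsto z atTop (𝓝 a)) :
    (∀ᶠ t in atTop, fatou a c n (z t) ∈ Complex.slitPlane) ∧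
      Tendsto (fun t => (fatou a c n (z t)).arg) atTop (𝓝 0) := by
  have h1 : Tendsto (fun t => F (z t) / (c * (z t - a) ^ (n + 1))) atTop (𝓝 1) := by
    have := (hlim.comp (tendsto_nhdsWithin_iff.2 ⟨hza, hne⟩)).div_const c
    rw [div_self hc] at this
    refine this.congr fun t => ?_
    simp [div_div, mul_comm]
  have h2 := tendsto_div_atTop_of_deriv (by
    filter_upwards [hz, hne] with t h h' using hasDerivAt_fatou_comp hn hc h h') h1
  have hcongr : ∀ᶠ t : ℝ in atTop, (t : ℂ) * (fatou a c n (z t) / t) = fatou a c n (z t) ∧ 0 < t := by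
    filter_upwards [eventually_gt_atTop 0] with t ht
    have : (t : ℂ) ≠ 0 := by exact_mod_cast ht.ne'
    exact ⟨by field_simp, ht⟩
  constructor
  · filter_upwards [hcongr, h2.eventually (Complex.isOpen_slitPlane.mem_nhds
      Complex.one_mem_slitPlane)] with t ⟨ht, ht0⟩ h
    have h := Complex.mem_slitPlane_iff_arg.1 h
    rw [← ht, Complex.mem_slitPlane_iff_arg, Complex.arg_real_mul _ ht0]
    exact ⟨h.1, mul_ne_zero (by exact_mod_cast ht0.ne') h.2⟩
  · have h3 := (Complex.continuousAt_arg Complex.one_mem_slitPlane).tendsto.comp h2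
    rw [Complex.arg_one] at h3
    refine h3.congr' ?_
    filter_upwards [hcongr] with t ⟨ht, ht0⟩
    rw [Function.comp_apply, ← Complex.arg_real_mul _ ht0, ht]

/-- An orbit tending to `a` is eventually in the region where `fatou` avoids the negative axis, so
`arg (z - a)` differs from a constant by `arg (fatou z) / n`, which tends to `0`. -/
theorem TendsForward.exists_tendsto_arg (hΩ : IsOpen Ω) (hF : DifferentiableOn ℂ F Ω) (ha : a ∈ Ω)
    (hFa : F a = 0) (hn : n ≠ 0) (hc : c ≠ 0)
    (hlim : Tendsto (fun z => F z / (z - a) ^ (n + 1)) (𝓝[≠] a) (𝓝 c)) (hx₀ : x₀ ∈ Ω)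
    (hne : x₀ ≠ a) (h : TendsForward Ω F a x₀) :
    ∃ θ : Real.Angle, n • θ + c.arg = Real.pi ∧ (∀ᶠ t in atTop, flow Ω F x₀ t ≠ a) ∧
      Tendsto (fun t => ((flow Ω F x₀ t - a).arg : Real.Angle)) atTop (𝓝 θ) := by
  have hx := isSolution_flow hΩ hF hx₀
  have hmem : ∀ᶠ t in atTop, t ∈ maxInterval Ω F x₀ := by
    filter_upwards [eventually_ge_atTop 0] with t ht using h.1 ht
  have hd : ∀ᶠ t in atTop, HasDerivAt (flow Ω F x₀) (F (flow Ω F x₀ t)) t := by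
    filter_upwards [hmem] with t ht using hx.hasDerivAt t ht
  have hne' : ∀ᶠ t in atTop, flow Ω F x₀ t ≠ a := by
    filter_upwards [hmem] with t ht using hx.ne_of_ne hΩ hF ha hFa hne ht
  obtain ⟨hslit, harg⟩ := tendsto_arg_fatou_flow hn hc hlim hd hne' h.2
  obtain ⟨T, hT⟩ := eventually_atTop.1 ((hd.and hne').and hslit)
  have hdiv : Tendsto (fun t => (((fatou a c n (flow Ω F x₀ t)).arg / n : ℝ) : Real.Angle)) atTop
      (𝓝 0) := by
    have := (Real.Angle.continuous_coe.tendsto 0).comp (by simpa using harg.div_const (n : ℝ))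
    simpa using! this
  have hconst := (tendsto_const_nhds (x := (((flow Ω F x₀ T - a).arg : Real.Angle) +
    ((fatou a c n (flow Ω F x₀ T)).arg / n : ℝ)))).sub hdiv
  rw [sub_zero] at hconst
  have hθ := hconst.congr' (f₂ := fun t => ((flow Ω F x₀ t - a).arg : Real.Angle)) (by
    filter_upwards [eventually_ge_atTop T] with t ht
    rw [arg_add_arg_fatou_const hn (isPreconnected_Ici (a := T))
      (fun s hs => (hT s hs).1.1.continuousAt.continuousWithinAt) (fun s hs => (hT s hs).1.2)
      (fun s hs => (hT s hs).2) self_mem_Ici (mem_Ici.2 ht)]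
    abel)
  refine ⟨_, ?_, hne', hθ⟩
  have h1 : Tendsto (fun t => ((fatou a c n (flow Ω F x₀ t)).arg : Real.Angle)) atTop (𝓝 0) := by
    simpa using! (Real.Angle.continuous_coe.tendsto 0).comp harg
  have h2 := (tendsto_const_nhds (x := (Real.pi - c.arg : Real.Angle))).sub (hθ.const_smul n)
  have h3 := tendsto_nhds_unique h1 (h2.congr' (by
    filter_upwards [hne'] with t ht using (coe_arg_fatou hn hc ht).symm))
  rw [eq_comm, sub_eq_zero, sub_eq_iff_eq_add] at h3
  exact h3.symm

/-! ### Attracting sectors -/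

theorem abs_arg_lt_pi_div_four_iff {w : ℂ} (hw : w ≠ 0) :
    |w.arg| < Real.pi / 4 ↔ |w.im| < w.re := by
  by_cases hre : 0 < w.re
  · have h1 := abs_lt.1 (Complex.abs_arg_lt_pi_div_two_iff.2 (Or.inl hre))
    rw [← Real.arctan_tan h1.1 h1.2, Complex.tan_arg, ← Real.arctan_one, abs_lt, abs_lt,
      ← Real.arctan_neg, Real.arctan_strictMono.lt_iff_lt, Real.arctan_strictMono.lt_iff_lt,
      lt_div_iff₀ hre, div_lt_iff₀ hre]
    simp
  · refine iff_of_false (fun h => hre ?_) fun h => hre ((abs_nonneg _).trans_lt h)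
    exact (Complex.abs_arg_lt_pi_div_two_iff.1
      (h.trans (by linarith [Real.pi_pos]))).resolve_right hw

/-- A sector of half-width `π / (4 n)` around a direction in which `fatou` is positive corresponds
to the part of the sector `|arg w| < π / 4` which lies in one sheet of the `n`-fold covering
`fatou`. -/
theorem mem_sector_iff (hn : n ≠ 0) (hc : c ≠ 0)
    (hθ : n • (θ₀ : Real.Angle) + c.arg = Real.pi) {z : ℂ} :
    z ∈ sector a θ₀ r (Real.pi / (4 * n)) ↔ z ≠ a ∧ ‖z - a‖ < r ∧
      |(fatou a c n z).im| < (fatou a c n z).re ∧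
      ((z - a).arg + ((fatou a c n z).arg / n : ℝ) : Real.Angle) = θ₀ := by
  have hpi := Real.pi_pos
  have hn' : (0 : ℝ) < n := by positivity
  have hn1 : (1 : ℝ) ≤ n := by exact_mod_cast Nat.one_le_iff_ne_zero.2 hn
  refine and_congr_right fun hz => and_congr_right fun _ => ?_
  have hw := fatou_ne_zero (a := a) hn hc hz
  have harg := coe_arg_fatou (a := a) hn hc hz
  rw [← abs_arg_lt_pi_div_four_iff hw, lt_div_iff₀ (by positivity)]
  constructor
  · intro h
    set η := (((z - a).arg : Real.Angle) - (θ₀ : Real.Angle)).toReal with hη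
    have hcoe : (η : Real.Angle) = (z - a).arg - θ₀ := Real.Angle.coe_toReal _
    have hnη : |-(n * η)| < Real.pi / 4 := by
      rw [abs_neg, abs_mul, abs_of_pos hn']
      linarith
    have h1 : ((fatou a c n z).arg : Real.Angle) = (-(n * η) : ℝ) := by
      rw [harg, Real.Angle.coe_neg, ← nsmul_eq_mul, Real.Angle.coe_nsmul, hcoe, ← hθ, smul_sub]
      abel
    have h2 : (fatou a c n z).arg = -(n * η) := by
      have := congrArg Real.Angle.toReal h1
      rw [Complex.arg_coe_angle_toReal_eq_arg] at this
      rw [this, Real.Angle.toReal_coe_eq_self_iff]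
      constructor <;> linarith [(abs_lt.1 hnη).1, (abs_lt.1 hnη).2]
    rw [h2]
    refine ⟨hnη, ?_⟩
    rw [neg_div, mul_div_cancel_left₀ _ hn'.ne', Real.Angle.coe_neg, hcoe]
    abel
  · rintro ⟨h1, h2⟩
    have h3 : |-((fatou a c n z).arg / n)| * (4 * n) < Real.pi := by
      rw [abs_neg, abs_div, abs_of_pos hn', div_mul_eq_mul_div, div_lt_iff₀ hn']
      nlinarith
    have h4 : |-((fatou a c n z).arg / n)| < Real.pi := by
      nlinarith [abs_nonneg (-((fatou a c n z).arg / n))]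
    have h5 : (((z - a).arg : Real.Angle) - (θ₀ : Real.Angle)) =
        (-((fatou a c n z).arg / n) : ℝ) := by
      rw [← h2, Real.Angle.coe_neg]
      abel
    rw [h5, Real.Angle.toReal_coe_eq_self_iff.2 ⟨(abs_lt.1 h4).1, (abs_lt.1 h4).2.le⟩]
    exact h3

/-- The cone `|im w| < re w` is invariant under displacements that are nearly real and positive, and
the distance from the origin does not decrease. -/
theorem cone_add {w v : ℂ} {s : ℝ} (hw : |w.im| < w.re) (hv : ‖v - s‖ ≤ 1 / 4 * s) :
    |(w + v).im| < (w + v).re ∧ ‖w‖ ≤ ‖w + v‖ ∧ 3 / 4 * s ≤ ‖w + v‖ := by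
  have h1 := (Complex.abs_re_le_norm (v - s)).trans hv
  have h2 := (Complex.abs_im_le_norm (v - s)).trans hv
  simp only [Complex.sub_re, Complex.sub_im, Complex.ofReal_re, Complex.ofReal_im, sub_zero,
    abs_le] at h1 h2
  rw [abs_lt] at hw
  have hre : 3 / 4 * s ≤ (w + v).re := by rw [Complex.add_re]; linarith
  refine ⟨?_, ?_, hre.trans ((le_abs_self _).trans (Complex.abs_re_le_norm _))⟩
  · rw [abs_lt, Complex.add_re, Complex.add_im]
    constructor <;> linarith
  · have hvre : |v.im| ≤ v.re := abs_le.2 ⟨by linarith, by linarith⟩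
    have hdot : 0 ≤ w.re * v.re + w.im * v.im := by
      have := mul_le_mul (abs_lt.2 hw).le hvre (abs_nonneg _) (by linarith)
      rw [← abs_mul] at this
      linarith [neg_abs_le (w.im * v.im)]
    rw [← sq_le_sq₀ (norm_nonneg _) (norm_nonneg _), ← Complex.normSq_eq_norm_sq,
      ← Complex.normSq_eq_norm_sq, Complex.normSq_add, Complex.mul_re, Complex.conj_re,
      Complex.conj_im]
    linarith [Complex.normSq_nonneg v]

/-- An orbit starting close to `a` with `|im (fatou z)| < re (fatou z)` never gets farther away from
`a`, and `fatou` moves along it with velocity close to `1`. -/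
theorem IsSolution.norm_fatou_sub_le (hn : n ≠ 0) (hc : c ≠ 0)
    (hr : ∀ z, z ≠ a → ‖z - a‖ < r → ‖F z / (c * (z - a) ^ (n + 1)) - 1‖ ≤ 1 / 4)
    {I : Set ℝ} {x : ℝ → ℂ} (hx : IsSolution Ω F x₀ I x) (hne : ∀ t ∈ I, x t ≠ a)
    (hx₀ : ‖x₀ - a‖ < r) (hcone : |(fatou a c n x₀).im| < (fatou a c n x₀).re)
    {t : ℝ} (ht : t ∈ I) (ht0 : 0 ≤ t) :
    ‖(fatou a c n (x t) - fatou a c n x₀) - t‖ ≤ 1 / 4 * t := by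
  have hI : ∀ {u}, u ∈ Icc 0 t → u ∈ I := fun hu => hx.ordConnected.out hx.zero_mem ht hu
  have bound : ∀ s ∈ Icc 0 t, (∀ u ∈ Ico 0 s, ‖x u - a‖ < r) →
      ‖(fatou a c n (x s) - fatou a c n x₀) - s‖ ≤ 1 / 4 * s := by
    intro s hs hball
    have hIs : ∀ {u}, u ∈ Icc 0 s → u ∈ I := fun hu => hI ⟨hu.1, hu.2.trans hs.2⟩
    have := norm_image_sub_le_of_norm_deriv_le_segment' (a := 0) (b := s) (C := 1 / 4)
      (f := fun u : ℝ => fatou a c n (x u) - u)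
      (f' := fun u => F (x u) / (c * (x u - a) ^ (n + 1)) - 1)
      (fun u hu => ((hasDerivAt_fatou_comp hn hc (hx.hasDerivAt u (hIs hu)) (hne u (hIs hu))).sub
        (HasDerivAt.ofReal_comp (hasDerivAt_id u))).hasDerivWithinAt)
      (fun u hu => hr _ (hne u (hIs ⟨hu.1, hu.2.le⟩)) (hball u hu)) s ⟨hs.1, le_rfl⟩
    simp only [hx.initial, Complex.ofReal_zero, sub_zero] at this
    rwa [sub_right_comm]
  refine bound t ⟨ht0, le_rfl⟩ ?_
  by_contra! hbad
  obtain ⟨u₀, hu₀, hu₀r⟩ := hbad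
  -- The first time `s` at which the orbit leaves the ball of radius `r` would have `fatou (x s)`
  -- farther from `0` than `fatou x₀`, that is, `x s` closer to `a` than `x₀`.
  have hcont : ContinuousOn (fun u => ‖x u - a‖) (Icc 0 t) := fun u hu =>
    ((hx.hasDerivAt u (hI hu)).continuousAt.continuousWithinAt.sub
      continuousWithinAt_const).norm
  obtain ⟨s, ⟨hs, hsr⟩, hmin⟩ :=
    (isCompact_Icc.of_isClosed_subset (hcont.preimage_isClosed_of_isClosed isClosed_Icc isClosed_Ici)
      inter_subset_left).exists_isLeast ⟨u₀, ⟨hu₀.1, hu₀.2.le⟩, mem_Ici.2 hu₀r⟩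
  have h1 := bound s hs fun u hu => lt_of_not_ge fun h =>
    hu.2.not_ge (hmin ⟨⟨hu.1, hu.2.le.trans hs.2⟩, h⟩)
  have h2 := (cone_add hcone h1).2.1
  rw [add_sub_cancel] at h2
  have h3 := norm_sub_le_of_norm_fatou_le hn hc (hne s (hI hs))
    (hx.initial ▸ hne 0 hx.zero_mem) h2
  exact absurd hx₀ (not_lt.2 (le_trans hsr h3))

/-- Orbits starting in a small sector around a direction in which `fatou` is positive stay in this
sector and tend to `a` in this direction. -/
theorem forward_of_mem_sector (hΩ : IsOpen Ω) (hF : DifferentiableOn ℂ F Ω) (ha : a ∈ Ω)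
    (hFa : F a = 0) (hn : n ≠ 0) (hc : c ≠ 0)
    (hlim : Tendsto (fun z => F z / (z - a) ^ (n + 1)) (𝓝[≠] a) (𝓝 c))
    (hrΩ : Metric.ball a r ⊆ Ω)
    (hr : ∀ z, z ≠ a → ‖z - a‖ < r → ‖F z / (c * (z - a) ^ (n + 1)) - 1‖ ≤ 1 / 4)
    (hθ : n • (θ₀ : Real.Angle) + c.arg = Real.pi)
    (hx₀ : x₀ ∈ sector a θ₀ r (Real.pi / (4 * n))) :
    forwardOrbit Ω F x₀ ⊆ sector a θ₀ r (Real.pi / (4 * n)) ∧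
      TendsForwardInDirection Ω F a x₀ θ₀ := by
  obtain ⟨hne, hxr, hcone, harg⟩ := (mem_sector_iff hn hc hθ).1 hx₀
  have hx₀Ω : x₀ ∈ Ω := hrΩ (mem_ball_iff_norm.2 hxr)
  have hx := isSolution_flow hΩ hF hx₀Ω
  have hne' : ∀ t ∈ maxInterval Ω F x₀, flow Ω F x₀ t ≠ a := fun t ht =>
    hx.ne_of_ne hΩ hF ha hFa hne ht
  have hcone' : ∀ t ∈ maxInterval Ω F x₀, 0 ≤ t →
      |(fatou a c n (flow Ω F x₀ t)).im| < (fatou a c n (flow Ω F x₀ t)).re ∧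
      ‖flow Ω F x₀ t - a‖ ≤ ‖x₀ - a‖ ∧ 3 / 4 * t ≤ ‖fatou a c n (flow Ω F x₀ t)‖ := by
    intro t ht ht0
    have h := cone_add hcone (hx.norm_fatou_sub_le hn hc hr hne' hxr hcone ht ht0)
    rw [add_sub_cancel] at h
    exact ⟨h.1, norm_sub_le_of_norm_fatou_le hn hc (hne' t ht) hne h.2.1, h.2.2⟩
  have hslit : ∀ t ∈ maxInterval Ω F x₀, 0 ≤ t →
      fatou a c n (flow Ω F x₀ t) ∈ Complex.slitPlane := fun t ht ht0 =>
    Or.inl ((abs_nonneg _).trans_lt (hcone' t ht ht0).1)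
  have harg' : ∀ t ∈ maxInterval Ω F x₀, 0 ≤ t → ((flow Ω F x₀ t - a).arg +
      ((fatou a c n (flow Ω F x₀ t)).arg / n : ℝ) : Real.Angle) = θ₀ := by
    intro t ht ht0
    have hI : ∀ {u}, u ∈ Icc 0 t → u ∈ maxInterval Ω F x₀ := fun hu =>
      hx.ordConnected.out hx.zero_mem ht hu
    rw [arg_add_arg_fatou_const hn (isPreconnected_Icc (a := 0) (b := t))
      (fun s hs => (hx.hasDerivAt s (hI hs)).continuousAt.continuousWithinAt)
      (fun s hs => hne' s (hI hs)) (fun s hs => hslit s (hI hs) hs.1)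
      (right_mem_Icc.2 ht0) (left_mem_Icc.2 ht0), hx.initial, harg]
  have hIci : Ici 0 ⊆ maxInterval Ω F x₀ :=
    Ici_subset_maxInterval_of_isCompact hΩ hF hx₀Ω (isCompact_closedBall a ‖x₀ - a‖)
      ((Metric.closedBall_subset_ball hxr).trans hrΩ) fun t ht ht0 =>
        mem_closedBall_iff_norm.2 (hcone' t ht ht0).2.1
  have hfatou : Tendsto (fun t => ‖fatou a c n (flow Ω F x₀ t)‖) atTop atTop := by
    refine tendsto_atTop_mono' _ ?_ (tendsto_id.const_mul_atTop (by norm_num : (0 : ℝ) < 3 / 4))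
    filter_upwards [eventually_ge_atTop 0] with t ht using (hcone' t (hIci ht) ht).2.2
  have hlima : Tendsto (flow Ω F x₀) atTop (𝓝 a) := by
    have hc' : (0 : ℝ) < n * ‖c‖ := by
      have := norm_pos_iff.2 hc
      positivity
    have h1 := hfatou.inv_tendsto_atTop.const_mul (n * ‖c‖)⁻¹
    rw [mul_zero] at h1
    have h2 : Tendsto (fun t => ‖flow Ω F x₀ t - a‖ ^ n) atTop (𝓝 0) := by
      refine h1.congr fun t => ?_
      simp only [Pi.inv_apply, norm_fatou, inv_inv]
      field_simp
    rw [tendsto_iff_norm_sub_tendsto_zero]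
    have h3 := h2.rpow_const (p := (n : ℝ)⁻¹) (Or.inr (by positivity))
    rw [Real.zero_rpow (by positivity)] at h3
    exact h3.congr fun t => Real.pow_rpow_inv_natCast (norm_nonneg _) hn
  have htends : TendsForward Ω F a x₀ := ⟨hIci, hlima⟩
  have hev : ∀ᶠ t in atTop, flow Ω F x₀ t ≠ a := by
    filter_upwards [eventually_ge_atTop 0] with t ht using hne' t (hIci ht)
  refine ⟨?_, htends, hev, ?_⟩
  · rintro _ ⟨t, ⟨ht, ht0⟩, rfl⟩
    obtain ⟨h1, h2, -⟩ := hcone' t ht ht0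
    exact (mem_sector_iff hn hc hθ).2 ⟨hne' t ht, h2.trans_lt hxr, h1, harg' t ht ht0⟩
  · have hd : ∀ᶠ t in atTop, HasDerivAt (flow Ω F x₀) (F (flow Ω F x₀ t)) t := by
      filter_upwards [eventually_ge_atTop 0] with t ht using hx.hasDerivAt t (hIci ht)
    have h1 := (tendsto_arg_fatou_flow hn hc hlim hd hev hlima).2.div_const (n : ℝ)
    rw [zero_div] at h1
    have h2 := (tendsto_const_nhds (x := (θ₀ : Real.Angle))).sub
      ((Real.Angle.continuous_coe.tendsto 0).comp h1)
    rw [Real.Angle.coe_zero, sub_zero] at h2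
    refine h2.congr' ?_
    filter_upwards [eventually_ge_atTop 0] with t ht
    rw [← harg' t (hIci ht) ht]
    exact add_sub_cancel_right _ _

/-! ### The characteristic directions -/

/-- The degree `m` part of the Taylor series of the real function `L ∘ F` is `L` applied to the
degree `m` term of the complex Taylor series of `F`. -/
theorem taylorPart_clm (L : ℂ →L[ℝ] ℝ) (hF : AnalyticAt ℂ F a) (x₁ x₂ : ℝ) :
    taylorPart (fun z => L (F z)) a m x₁ x₂ =
      L ((m.factorial : ℂ)⁻¹ * iteratedDeriv m F a * (⟨x₁, x₂⟩ : ℂ) ^ m) := by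
  have hd : ContDiffAt ℂ m F a := hF.contDiffAt
  have h1 := L.iteratedFDeriv_comp_left (hd.restrict_scalars ℝ) le_rfl
  have h2 := hd.restrictScalars_iteratedFDeriv (𝕜 := ℝ)
  have h3 : iteratedFDeriv ℝ m (fun z => L (F z)) a (fun _ => (⟨x₁, x₂⟩ : ℂ)) =
      L (iteratedDeriv m F a * (⟨x₁, x₂⟩ : ℂ) ^ m) := by
    rw [show (fun z => L (F z)) = L ∘ F from rfl, h1, ← h2]
    simp [iteratedFDeriv_apply_eq_iteratedDeriv_mul_prod, mul_comm]
  rw [taylorPart, h3, ← smul_eq_mul, ← map_smul, Complex.real_smul, mul_assoc]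
  simp

theorem H_cos_sin (hF : AnalyticAt ℂ F a) (θ : ℝ) :
    H F a (n + 1) (Real.cos θ) (Real.sin θ) = ((n + 1).factorial : ℝ)⁻¹ *
      ‖iteratedDeriv (n + 1) F a‖ * Real.sin ((iteratedDeriv (n + 1) F a).arg + n * θ) := by
  have hv : (⟨Real.cos θ, Real.sin θ⟩ : ℂ) = Complex.exp (θ * Complex.I) := by
    apply Complex.ext <;> simp [Complex.exp_ofReal_mul_I_re, Complex.exp_ofReal_mul_I_im]
  set C := iteratedDeriv (n + 1) F a with hC
  have hCv : C * Complex.exp (θ * Complex.I) ^ n =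
      ‖C‖ * Complex.exp ((C.arg + n * θ : ℝ) * Complex.I) := by
    conv_lhs => rw [← Complex.norm_mul_exp_arg_mul_I C]
    rw [← Complex.exp_nat_mul, mul_assoc, ← Complex.exp_add]
    push_cast
    ring_nf
  have him := taylorPart_clm (m := n + 1) Complex.imCLM hF (Real.cos θ) (Real.sin θ)
  have hre := taylorPart_clm (m := n + 1) Complex.reCLM hF (Real.cos θ) (Real.sin θ)
  simp only [Complex.imCLM_apply, Complex.reCLM_apply] at him hre
  have hfac : ((n + 1).factorial : ℂ)⁻¹ = ((((n + 1).factorial : ℝ)⁻¹ : ℝ) : ℂ) := by push_cast; rfl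
  rw [H, him, hre, ← hC, hv, hfac, mul_assoc, pow_succ, ← mul_assoc C, hCv, Complex.re_ofReal_mul,
    Complex.im_ofReal_mul, mul_assoc, Complex.re_ofReal_mul, Complex.im_ofReal_mul, Complex.mul_re,
    Complex.mul_im, Complex.exp_ofReal_mul_I_re, Complex.exp_ofReal_mul_I_im,
    Complex.exp_ofReal_mul_I_re, Complex.exp_ofReal_mul_I_im]
  linear_combination (((n + 1).factorial : ℝ)⁻¹ * ‖C‖ * Real.sin (C.arg + n * θ)) *
    Real.sin_sq_add_cos_sq θ

theorem mem_directions_iff (hn : n ≠ 0) :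
    θ₀ ∈ directions F a (n + 1) ↔ θ₀ ∈ Ico 0 (2 * Real.pi) ∧
      Real.sin ((iteratedDeriv (n + 1) F a).arg + n * θ₀) = 0 := by
  have hn' : (n : ℝ) ≠ 0 := by exact_mod_cast hn
  simp only [directions, mem_range, Nat.cast_add, Nat.cast_one, add_sub_cancel_right,
    toIcoMod_eq_iff, zero_add]
  constructor
  · rintro ⟨ℓ, h, k, hk⟩
    refine ⟨h, Real.sin_eq_zero_iff.2 ⟨ℓ - 2 * n * k, ?_⟩⟩
    rw [div_eq_iff hn'] at hk
    simp only [zsmul_eq_mul] at hk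
    push_cast
    linear_combination hk
  · rintro ⟨h, hs⟩
    obtain ⟨ℓ, hℓ⟩ := Real.sin_eq_zero_iff.1 hs
    refine ⟨ℓ, h, 0, ?_⟩
    rw [hℓ, zero_smul]
    field_simp
    ring

theorem ncard_directions (hn : n ≠ 0) : (directions F a (n + 1)).ncard = 2 * n := by
  have hn' : (n : ℝ) ≠ 0 := by exact_mod_cast hn
  have hpi := Real.pi_ne_zero
  set f : ℤ → ℝ := fun ℓ => toIcoMod Real.two_pi_pos 0
    ((ℓ * Real.pi - (iteratedDeriv (n + 1) F a).arg) / (((n + 1 : ℕ) : ℝ) - 1)) with hf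
  -- The angle of index `ℓ` depends exactly on the residue class of `ℓ` modulo `2 n`.
  have key : ∀ ℓ ℓ' : ℤ, f ℓ = f ℓ' ↔ ℓ ≡ ℓ' [ZMOD (2 * n : ℤ)] := by
    intro ℓ ℓ'
    rw [hf, toIcoMod_eq_toIcoMod, Int.modEq_iff_dvd]
    refine exists_congr fun k => ?_
    rw [← @Int.cast_inj ℝ]
    push_cast
    rw [zsmul_eq_mul, add_sub_cancel_right, ← sub_div, div_eq_iff hn', sub_sub_sub_cancel_right,
      ← sub_mul]
    constructor <;> intro h
    · apply mul_right_cancel₀ hpi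
      linear_combination h
    · linear_combination Real.pi * h
  have h2n : (0 : ℤ) < 2 * n := by positivity
  have himage : directions F a (n + 1) = f '' Ico (0 : ℤ) (2 * n) := by
    refine Subset.antisymm ?_ (image_subset_range _ _)
    rintro _ ⟨ℓ, rfl⟩
    exact ⟨ℓ % (2 * n), ⟨Int.emod_nonneg _ h2n.ne', Int.emod_lt_of_pos _ h2n⟩,
      (key _ _).2 (Int.mod_modEq _ _)⟩
  have hinj : InjOn f (Ico (0 : ℤ) (2 * n)) := fun ℓ hℓ ℓ' hℓ' h => by
    have := (key _ _).1 h
    rwa [Int.ModEq, Int.emod_eq_of_lt hℓ.1 hℓ.2, Int.emod_eq_of_lt hℓ'.1 hℓ'.2] at this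
  rw [himage, hinj.ncard_image, ← Finset.coe_Ico, ncard_coe_finset, Int.card_Ico]
  omega

/-! ### Leading coefficient and signs -/

/-- At a zero of order `m`, `F z / (z - a) ^ m` tends to the leading Taylor coefficient. -/
theorem tendsto_div_pow (hF : AnalyticAt ℂ F a) (h0 : ∀ k < m, iteratedDeriv k F a = 0) :
    Tendsto (fun z => F z / (z - a) ^ m) (𝓝[≠] a)
      (𝓝 ((m.factorial : ℂ)⁻¹ * iteratedDeriv m F a)) := by
  have hG : AnalyticAt ℂ (fun z => F (a + z)) 0 :=
    AnalyticAt.fun_comp (by simpa using hF) (by fun_prop)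
  obtain ⟨G, hGa, hGeq⟩ := hG.exists_eq_sum_add_pow_mul (m + 1)
  simp only [iteratedDeriv_comp_const_add, add_zero, Finset.sum_range_succ] at hGeq
  have hcont : ContinuousAt (fun z => (m.factorial : ℂ)⁻¹ * iteratedDeriv m F a +
      (z - a) * G (z - a)) a := by
    have : ContinuousAt (fun z => G (z - a)) a :=
      ContinuousAt.comp (f := fun z => z - a) (by simpa using hGa.continuousAt) (by fun_prop)
    exact continuousAt_const.add ((continuousAt_id.sub continuousAt_const).mul this)
  have hlim := hcont.tendsto.mono_left (nhdsWithin_le_nhds (s := {a}ᶜ))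
  simp only [sub_self, zero_mul, add_zero] at hlim
  refine hlim.congr' ?_
  filter_upwards [self_mem_nhdsWithin] with z hz
  have hz' : z - a ≠ 0 := sub_ne_zero.2 hz
  have h := hGeq (z - a)
  rw [Finset.sum_eq_zero fun i hi => by rw [h0 i (Finset.mem_range.1 hi), smul_zero]] at h
  rw [add_sub_cancel, smul_eq_mul, smul_eq_mul] at h
  rw [h, pow_succ]
  field_simp
  ring

/-- A zero `θ₀` of the sine has negative `λ` exactly when `c e^(i n θ₀)` is negative, that is when
the coordinate `fatou` is positive on the ray in direction `θ₀`. -/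
theorem lam_neg_iff (hs : Real.sin (c.arg + n * θ₀) = 0) :
    Real.cos (c.arg + θ₀ * n) < 0 ↔ n • (θ₀ : Real.Angle) + c.arg = Real.pi := by
  rw [add_comm] at hs
  rw [← Real.Angle.coe_nsmul, ← Real.Angle.coe_add, nsmul_eq_mul, add_comm, mul_comm θ₀]
  constructor
  · intro h
    refine Real.Angle.cos_sin_inj ?_ (by rw [hs, Real.sin_pi])
    rw [Real.cos_pi]
    rcases Real.sin_eq_zero_iff_cos_eq.1 hs with h1 | h1
    · linarith
    · exact h1
  · intro h
    have := congrArg Real.Angle.cos h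
    rw [Real.Angle.cos_coe, Real.Angle.cos_coe, Real.cos_pi] at this
    linarith

/-- The counterpart of `lam_neg_iff` for the reversed vector field, with leading coefficient `-c`. -/
theorem lam_pos_iff (hc : c ≠ 0) (hs : Real.sin (c.arg + n * θ₀) = 0) :
    0 < Real.cos (c.arg + θ₀ * n) ↔ n • (θ₀ : Real.Angle) + (-c).arg = Real.pi := by
  rw [add_comm] at hs
  rw [Complex.arg_neg_coe_angle hc, ← add_assoc, add_eq_right, ← Real.Angle.coe_nsmul,
    ← Real.Angle.coe_add, nsmul_eq_mul, add_comm, mul_comm θ₀]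
  constructor
  · intro h
    refine Real.Angle.cos_sin_inj ?_ (by rw [hs, Real.sin_zero])
    rw [Real.cos_zero]
    rcases Real.sin_eq_zero_iff_cos_eq.1 hs with h1 | h1
    · exact h1
    · linarith
  · intro h
    have := congrArg Real.Angle.cos h
    rw [Real.Angle.cos_coe, ← Real.Angle.coe_zero, Real.Angle.cos_coe, Real.cos_zero] at this
    linarith

/-- Orbits tend to `a` for `t → ∞` only along directions on which `fatou` is positive. -/
theorem TendsForwardInDirection.nsmul_add_arg (hΩ : IsOpen Ω) (hF : DifferentiableOn ℂ F Ω)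
    (ha : a ∈ Ω) (hFa : F a = 0) (hn : n ≠ 0) (hc : c ≠ 0)
    (hlim : Tendsto (fun z => F z / (z - a) ^ (n + 1)) (𝓝[≠] a) (𝓝 c)) (hx₀ : x₀ ∈ Ω)
    (hne : x₀ ≠ a) (h : TendsForwardInDirection Ω F a x₀ θ₀) :
    n • (θ₀ : Real.Angle) + c.arg = Real.pi := by
  obtain ⟨θ, hθ, -, hlimθ⟩ := h.1.exists_tendsto_arg hΩ hF ha hFa hn hc hlim hx₀ hne
  rwa [tendsto_nhds_unique h.2.2 hlimθ]

theorem TendsForward.exists_direction (hΩ : IsOpen Ω) (hF : DifferentiableOn ℂ F Ω) (ha : a ∈ Ω)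
    (hFa : F a = 0) (hn : n ≠ 0) (hc : c ≠ 0)
    (hlim : Tendsto (fun z => F z / (z - a) ^ (n + 1)) (𝓝[≠] a) (𝓝 c)) (hx₀ : x₀ ∈ Ω)
    (hne : x₀ ≠ a) (h : TendsForward Ω F a x₀) :
    ∃ θ₀ ∈ Ico 0 (2 * Real.pi), n • (θ₀ : Real.Angle) + c.arg = Real.pi ∧
      TendsForwardInDirection Ω F a x₀ θ₀ := by
  obtain ⟨θ, hθ, hne', hlimθ⟩ := h.exists_tendsto_arg hΩ hF ha hFa hn hc hlim hx₀ hne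
  have hcoe : ((toIcoMod Real.two_pi_pos 0 θ.toReal : ℝ) : Real.Angle) = θ := by
    rw [Real.Angle.coe_toIcoMod, Real.Angle.coe_toReal]
  refine ⟨_, by simpa using toIcoMod_mem_Ico Real.two_pi_pos 0 θ.toReal, ?_, h, hne', ?_⟩ <;>
    rwa [hcoe]

theorem sin_arg_add_eq_zero (h : n • (θ₀ : Real.Angle) + c.arg = Real.pi) :
    Real.sin (c.arg + n * θ₀) = 0 := by
  have := congrArg Real.Angle.sin h
  rwa [← Real.Angle.coe_nsmul, ← Real.Angle.coe_add, Real.Angle.sin_coe, Real.Angle.sin_coe,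
    Real.sin_pi, nsmul_eq_mul, add_comm] at this

end HolFlow

theorem mainTheorem3 (Ω : Set ℂ) (hΩ : IsOpen Ω) (hconn : IsConnected Ω) (F : ℂ → ℂ)
    (hF : DifferentiableOn ℂ F Ω) (hF0 : ∃ z ∈ Ω, F z ≠ 0) (a : ℂ) (ha : a ∈ Ω) (hFa : F a = 0)
    (m : ℕ) (hm : 2 ≤ m) (hord : analyticOrderAt F a = (m : ℕ∞)) :
    -- (i) the zeros of `H (cos θ₀, sin θ₀)`, and their number
    ((∀ θ₀ ∈ Set.Ico (0 : ℝ) (2 * Real.pi),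
        HolFlow.H F a m (Real.cos θ₀) (Real.sin θ₀) = 0 ↔ θ₀ ∈ HolFlow.directions F a m) ∧
      (HolFlow.directions F a m).ncard = 2 * m - 2) ∧
    -- (ii) every (non-constant) orbit tending to `a` does so in one of these directions
    (∀ x₀ ∈ Ω, x₀ ≠ a →
      (HolFlow.TendsForward Ω F a x₀ →
        ∃ θ₀ ∈ HolFlow.directions F a m, HolFlow.TendsForwardInDirection Ω F a x₀ θ₀) ∧
      (HolFlow.TendsBackward Ω F a x₀ →
        ∃ θ₀ ∈ HolFlow.directions F a m, HolFlow.TendsBackwardInDirection Ω F a x₀ θ₀)) ∧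
    (∀ θ₀ ∈ HolFlow.directions F a m, ∃ r > 0, ∃ δ > 0,
      -- (iii) each direction attracts all orbits starting in a sector around it
      (HolFlow.sector a θ₀ r δ ⊆ Ω ∧
        ∀ x₀ ∈ HolFlow.sector a θ₀ r δ,
          (HolFlow.TendsForwardInDirection Ω F a x₀ θ₀ ∨
            HolFlow.TendsBackwardInDirection Ω F a x₀ θ₀) ∧
          (HolFlow.TendsForwardInDirection Ω F a x₀ θ₀ ↔ HolFlow.lam F a m θ₀ < 0) ∧
          (HolFlow.TendsBackwardInDirection Ω F a x₀ θ₀ ↔ 0 < HolFlow.lam F a m θ₀)) ∧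
      -- (iv) half-orbits starting in a smaller sector stay in the sector
      (∃ r' ∈ Set.Ioo 0 r, ∃ δ' ∈ Set.Ioo 0 δ,
        ∀ x₀ ∈ HolFlow.sector a θ₀ r' δ',
          (HolFlow.lam F a m θ₀ < 0 →
            HolFlow.forwardOrbit Ω F x₀ ⊆ HolFlow.sector a θ₀ r δ) ∧
          (0 < HolFlow.lam F a m θ₀ →
            HolFlow.backwardOrbit Ω F x₀ ⊆ HolFlow.sector a θ₀ r δ))) := by
  have hFan : AnalyticAt ℂ F a := hF.analyticAt (hΩ.mem_nhds ha)
  obtain ⟨h0, hC⟩ := (analyticOrderAt_eq_nat_iff_iteratedDeriv_eq_zero hFan).1 hord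
  obtain ⟨n, rfl⟩ : ∃ n, m = n + 1 := ⟨m - 1, by omega⟩
  have hn : n ≠ 0 := by omega
  set C := iteratedDeriv (n + 1) F a with hCdef
  set c : ℂ := ((n + 1).factorial : ℂ)⁻¹ * C with hcdef
  have hfac : (0 : ℝ) < ((n + 1).factorial : ℝ)⁻¹ := by positivity
  have hc : c ≠ 0 := mul_ne_zero (by simp [Nat.factorial_ne_zero]) hC
  have hcarg : c.arg = C.arg := by
    rw [hcdef, ← Complex.arg_real_mul C hfac]
    push_cast
    rfl
  have hlim : Tendsto (fun z => F z / (z - a) ^ (n + 1)) (𝓝[≠] a) (𝓝 c) :=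
    HolFlow.tendsto_div_pow hFan h0
  have hFneg : DifferentiableOn ℂ (-F) Ω := hF.neg
  have hFaneg : (-F) a = 0 := by simp [hFa]
  have hlimneg : Tendsto (fun z => (-F) z / (z - a) ^ (n + 1)) (𝓝[≠] a) (𝓝 (-c)) :=
    hlim.neg.congr fun z => (neg_div _ _).symm
  have hdir : ∀ θ, θ ∈ HolFlow.directions F a (n + 1) ↔ θ ∈ Set.Ico 0 (2 * Real.pi) ∧
      Real.sin (c.arg + n * θ) = 0 := fun θ => by
    rw [hcarg]
    exact HolFlow.mem_directions_iff hn
  have hlam : ∀ θ, HolFlow.lam F a (n + 1) θ = Real.cos (c.arg + θ * n) := fun θ => by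
    rw [HolFlow.lam, hcarg]
    push_cast
    rw [add_sub_cancel_right]
  -- The assertions for `t → -∞` are those for `t → ∞` applied to `-F`, with coefficient `-c`.
  refine ⟨⟨fun θ hθ => ?_, ?_⟩, fun x₀ hx₀ hne => ⟨fun h => ?_, fun h => ?_⟩, fun θ hθ => ?_⟩
  · rw [HolFlow.H_cos_sin hFan, hdir, hcarg, and_iff_right hθ]
    simp [hC, Nat.factorial_ne_zero, ← hCdef]
  · rw [HolFlow.ncard_directions hn]
    omega
  · obtain ⟨θ, hθ, hθc, hdirθ⟩ :=
      h.exists_direction hΩ hF ha hFa hn hc hlim hx₀ hne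
    exact ⟨θ, (hdir θ).2 ⟨hθ, HolFlow.sin_arg_add_eq_zero hθc⟩, hdirθ⟩
  · obtain ⟨θ, hθ, hθc, hdirθ⟩ := ((HolFlow.tendsForward_neg hΩ hF).2 h).exists_direction hΩ hFneg
      ha hFaneg hn (neg_ne_zero.2 hc) hlimneg hx₀ hne
    refine ⟨θ, (hdir θ).2 ⟨hθ, ?_⟩, (HolFlow.tendsForwardInDirection_neg hΩ hF).1 hdirθ⟩
    rw [Complex.arg_neg_coe_angle hc, ← add_assoc, add_eq_right] at hθc
    have := congrArg Real.Angle.sin hθc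
    rwa [← Real.Angle.coe_nsmul, ← Real.Angle.coe_add, Real.Angle.sin_coe, Real.Angle.sin_zero,
      nsmul_eq_mul, add_comm] at this
  · have hs := ((hdir θ).1 hθ).2
    obtain ⟨r, hr0, hrΩ, hr⟩ : ∃ r > 0, Metric.ball a r ⊆ Ω ∧ ∀ z, z ≠ a → ‖z - a‖ < r →
        ‖F z / (c * (z - a) ^ (n + 1)) - 1‖ ≤ 1 / 4 := by
      have h1 : Tendsto (fun z => F z / (c * (z - a) ^ (n + 1))) (𝓝[≠] a) (𝓝 1) := by
        have := hlim.div_const c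
        rw [div_self hc] at this
        exact this.congr fun z => by rw [div_div, mul_comm]
      obtain ⟨r₁, hr₁, h2⟩ := Metric.mem_nhdsWithin_iff.1
        (h1 (Metric.closedBall_mem_nhds 1 (by norm_num : (0 : ℝ) < 1 / 4)))
      obtain ⟨r₂, hr₂, h3⟩ := Metric.mem_nhds_iff.1 (hΩ.mem_nhds ha)
      refine ⟨min r₁ r₂, lt_min hr₁ hr₂,
        (Metric.ball_subset_ball (min_le_right _ _)).trans h3, fun z hz hzr => ?_⟩
      have h4 : z ∈ Metric.ball a r₁ ∩ {a}ᶜ :=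
        ⟨mem_ball_iff_norm.2 (hzr.trans_le (min_le_left _ _)), hz⟩
      exact mem_closedBall_iff_norm.1 (h2 h4)
    have hrneg : ∀ z, z ≠ a → ‖z - a‖ < r →
        ‖(-F) z / (-c * (z - a) ^ (n + 1)) - 1‖ ≤ 1 / 4 := fun z hz hzr => by
      rw [Pi.neg_apply, neg_mul, neg_div_neg_eq]
      exact hr z hz hzr
    have hδ : 0 < Real.pi / (4 * n) := by
      have := Real.pi_pos
      positivity
    have hsector : HolFlow.sector a θ r (Real.pi / (4 * n)) ⊆ Ω := fun z hz =>
      hrΩ (mem_ball_iff_norm.2 hz.2.1)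
    have hneg := HolFlow.lam_neg_iff (n := n) (θ₀ := θ) hs
    have hpos := HolFlow.lam_pos_iff (n := n) (θ₀ := θ) hc hs
    rw [← hlam] at hneg hpos
    have hfwd := fun (h : HolFlow.lam F a (n + 1) θ < 0) x₀ hx₀ =>
      HolFlow.forward_of_mem_sector (x₀ := x₀) hΩ hF ha hFa hn hc hlim hrΩ hr (hneg.1 h) hx₀
    have hbwd := fun (h : 0 < HolFlow.lam F a (n + 1) θ) x₀ hx₀ =>
      HolFlow.forward_of_mem_sector (x₀ := x₀) hΩ hFneg ha hFaneg hn (neg_ne_zero.2 hc) hlimneg hrΩ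
        hrneg (hpos.1 h) hx₀
    simp only [HolFlow.tendsForwardInDirection_neg hΩ hF, HolFlow.forwardOrbit_neg hΩ hF] at hbwd
    -- The whole sector is invariant, so any smaller one serves in the last assertion.
    refine ⟨r, hr0, Real.pi / (4 * n), hδ, ⟨hsector, fun x₀ hx₀ => ⟨?_, ⟨fun h => ?_, fun h =>
      (hfwd h x₀ hx₀).2⟩, ⟨fun h => ?_, fun h => (hbwd h x₀ hx₀).2⟩⟩⟩,
      r / 2, ⟨by linarith, by linarith⟩, Real.pi / (4 * n) / 2, ⟨by linarith, by linarith⟩,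
      fun x₀ hx₀ => ?_⟩
    · have hne : HolFlow.lam F a (n + 1) θ ≠ 0 := by
        rw [hlam]
        rcases Real.sin_eq_zero_iff_cos_eq.1 hs with h | h <;> rw [mul_comm θ, h] <;> norm_num
      rcases hne.lt_or_gt with h | h
      · exact Or.inl (hfwd h x₀ hx₀).2
      · exact Or.inr (hbwd h x₀ hx₀).2
    · exact hneg.2 (h.nsmul_add_arg hΩ hF ha hFa hn hc hlim (hsector hx₀) hx₀.1)
    · exact hpos.2 (((HolFlow.tendsForwardInDirection_neg hΩ hF).2 h).nsmul_add_arg hΩ hFneg ha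
        hFaneg hn (neg_ne_zero.2 hc) hlimneg (hsector hx₀) hx₀.1)
    · have hx₀' : x₀ ∈ HolFlow.sector a θ r (Real.pi / (4 * n)) :=
        ⟨hx₀.1, by linarith [hx₀.2.1], by linarith [hx₀.2.2]⟩
      exact ⟨fun h => (hfwd h x₀ hx₀').1, fun h => (hbwd h x₀ hx₀').1⟩
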